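/- Let $I=[0,1]$ or $I=[0,\infty)$ with Lebesgue measure, and let $L^0(I)$ be the space of (a.e. classes of) measurable real functions on $I$. Let $\varphi:[0,\infty)\to[0,\infty]$ be an Orlicz function, i.e. $\varphi$ is convex, non-decreasing, left continuous on $(0,\infty)$, $\varphi(0)=0$, and $\varphi$ is neither identically $0$ nor identically $\infty$ on $(0,\infty)$. Put $a_\varphi=\sup\{u\ge 0:\varphi(u)=0\}$ and $b_\varphi=\sup\{u>0:\varphi(u)<\infty\}$. Let $I_\varphi(f)=\int_I\varphi(|f(t)|)\,dt$, let $L^\varphi=\{f\in L^0(I): I_\varphi(f/\lambda)<\infty\text{ for some }\lambda>0\}$ be the Orlicz space with norm $\|f\|_\varphi=\inf\{\lambda>0: I_\varphi(f/\lambda)\le 1\}$, let $Cf(x)=\frac1x\int_0^x f(t)\,dt$ for $0<x\in I$, and let $Ces_\varphi=\{f\in L^0(I): C|f|\in L^\varphi\}$ with norm $\|f\|=\|C|f|\|_\varphi$. Write $\varphi\in\Delta_2$ if: in the case $I=[0,1]$, there are $K>0$ and $u_0>0$ with $\varphi(u_0)<\infty$ and $\varphi(2u)\le K\varphi(u)$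 for all $u\ge u_0$; in the case $I=[0,\infty)$, there is $K>0$ with $\varphi(2u)\le K\varphi(u)$ for all $u\ge 0$. Assume that $\varphi<\infty$ (that is, $b_\varphi=\infty$), that $C$ maps $L^\varphi$ into $L^\varphi$, and, if $I=[0,1]$, that $\lim_{u\to\infty}\varphi(u)/u=\infty$. Then the following conditions are equivalent: (i) $Ces_\varphi$ is uniformly monotone: for every $\epsilon\in(0,1)$ there is $\delta\in(0,1)$ such that $\|x-y\|\le 1-\delta$ for all $x,y\in Ces_\varphi$ with $0\le y\le x$ a.e., $\|x\|=1$ and $\|y\|\ge\epsilon$; (ii) $Ces_\varphi$ is lower locally uniformly monotone: for every $x\in Ces_\varphi$ with $\|x\|=1$ and every $\epsilon\in(0,1)$ there is $\delta\in(0,1)$ such that $\|x-y\|\le 1-\delta$ for all $y\in Ces_\varphi$ with $0\le y\le x$ a.e. and $\|y\|\ge\epsilon$; (iii) $a_\varphi=0$ and $\varphi\in\Delta_2$. -/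

import Mathlib

open MeasureTheory Set Filter Topology
open scoped NNReal ENNReal

noncomputable section

namespace CesaroOrlicz

/-- The two underlying intervals: `[0, 1]` and `[0, ∞)`. -/
inductive Interval where
  | unit : Interval
  | halfLine : Interval

/-- The interval as a set of reals. -/
def Interval.toSet : Interval → Set ℝ
  | .unit => Icc 0 1
  | .halfLine => Ici 0

/-- Lebesgue measure on the interval. -/
def Interval.measure (I : Interval) : Measure ℝ := volume.restrict I.toSet

/-! ### Orlicz functions -/

/-- Orlicz functions `φ : [0, ∞) → [0, ∞]`. -/
structure IsOrliczFunction (φ : ℝ≥0 → ℝ≥0∞) : Prop where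
  convex : ConvexOn ℝ≥0 univ φ
  mono : Monotone φ
  map_zero : φ 0 = 0
  not_identically_zero : ∃ u, 0 < u ∧ φ u ≠ 0
  not_identically_top : ∃ u, 0 < u ∧ φ u ≠ ∞
  left_continuous : ∀ u, 0 < u → Tendsto φ (𝓝[<] u) (𝓝 (φ u))

/-- `a_φ = sup {u ≥ 0 : φ(u) = 0}`; one writes `φ > 0` when `a_φ = 0`. -/
def aIndex (φ : ℝ≥0 → ℝ≥0∞) : ℝ≥0∞ := ⨆ (u : ℝ≥0) (_ : φ u = 0), (u : ℝ≥0∞)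

/-- `b_φ = sup {u > 0 : φ(u) < ∞}`; one writes `φ < ∞` when `b_φ = ∞`. -/
def bIndex (φ : ℝ≥0 → ℝ≥0∞) : ℝ≥0∞ := ⨆ (u : ℝ≥0) (_ : 0 < u ∧ φ u < ∞), (u : ℝ≥0∞)

/-- The condition `Δ₂` for large arguments. -/
def DeltaTwoLarge (φ : ℝ≥0 → ℝ≥0∞) : Prop :=
  ∃ K u₀ : ℝ≥0, 0 < K ∧ 0 < u₀ ∧ φ u₀ < ∞ ∧ ∀ u, u₀ ≤ u → φ (2 * u) ≤ K * φ u

/-- The condition `Δ₂` for all arguments. -/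
def DeltaTwoAll (φ : ℝ≥0 → ℝ≥0∞) : Prop :=
  ∃ K : ℝ≥0, 0 < K ∧ ∀ u, φ (2 * u) ≤ K * φ u

/-- The condition `Δ₂` appropriate to the interval: for large arguments on `[0, 1]`,
for all arguments on `[0, ∞)`. -/
def DeltaTwo : Interval → (ℝ≥0 → ℝ≥0∞) → Prop
  | .unit, φ => DeltaTwoLarge φ
  | .halfLine, φ => DeltaTwoAll φ

/-! ### Function spaces -/

/-- A space of measurable functions on an interval with a norm. Elements are represented by
functions `ℝ → ℝ`, of which only the restriction to the interval matters, up to equality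
almost everywhere; the value of `norm` matters on `carrier` only. -/
structure FunctionSpace where
  carrier : Set (ℝ → ℝ)
  norm : (ℝ → ℝ) → ℝ

/-- The modular `I_φ(f) = ∫_I φ(|f(t)|) dt`. -/
def modular (I : Interval) (φ : ℝ≥0 → ℝ≥0∞) (f : ℝ → ℝ) : ℝ≥0∞ :=
  ∫⁻ t, φ ‖f t‖₊ ∂I.measure

/-- The Orlicz space `L^φ(I)` with the Luxemburg-Nakano norm. -/
def orliczSpace (I : Interval) (φ : ℝ≥0 → ℝ≥0∞) : FunctionSpace where
  carrier := {f | AEMeasurable f I.measure ∧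
    ∃ c : ℝ, 0 < c ∧ modular I φ (fun t => f t / c) < ∞}
  norm f := sInf {c : ℝ | 0 < c ∧ modular I φ (fun t => f t / c) ≤ 1}

/-- The continuous Cesàro operator `Cf(x) = (1/x) ∫_0^x f(t) dt`. -/
def cesaro (f : ℝ → ℝ) (x : ℝ) : ℝ := (1 / x) * ∫ t in (0 : ℝ)..x, f t

/-- The abstract Cesàro space `CX = {f ∈ L⁰(I) : C|f| ∈ X}` with the norm `‖C|f|‖_X`. The second
condition on `f` says that `C|f|` is finite almost everywhere on `I`. -/
def cesaroSpace (I : Interval) (X : FunctionSpace) : FunctionSpace where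
  carrier := {f | AEMeasurable f I.measure ∧
    (∀ᵐ x ∂I.measure, IntervalIntegrable (fun t => |f t|) volume 0 x) ∧
    cesaro (fun t => |f t|) ∈ X.carrier}
  norm f := X.norm (cesaro (fun t => |f t|))

/-- The Cesàro-Orlicz space `Ces_φ(I)`. -/
def cesaroOrliczSpace (I : Interval) (φ : ℝ≥0 → ℝ≥0∞) : FunctionSpace :=
  cesaroSpace I (orliczSpace I φ)

/-- `X` is uniformly monotone. -/
def UniformlyMonotone (I : Interval) (X : FunctionSpace) : Prop :=
  ∀ ε ∈ Ioo (0 : ℝ) 1, ∃ δ ∈ Ioo (0 : ℝ) 1, ∀ x ∈ X.carrier, ∀ y ∈ X.carrier,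
    0 ≤ᵐ[I.measure] y → y ≤ᵐ[I.measure] x → X.norm x = 1 → ε ≤ X.norm y →
      X.norm (x - y) ≤ 1 - δ

/-- `X` is lower locally uniformly monotone. -/
def LowerLocallyUniformlyMonotone (I : Interval) (X : FunctionSpace) : Prop :=
  ∀ x ∈ X.carrier, X.norm x = 1 → ∀ ε ∈ Ioo (0 : ℝ) 1, ∃ δ ∈ Ioo (0 : ℝ) 1,
    ∀ y ∈ X.carrier, 0 ≤ᵐ[I.measure] y → y ≤ᵐ[I.measure] x → ε ≤ X.norm y →
      X.norm (x - y) ≤ 1 - δ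

end CesaroOrlicz

end

/-! (iii) implies (i): convexity and `φ 0 = 0` make `φ` superadditive, and for `0 ≤ y ≤ x` the
operator gives `C|x - y| = C|x| - C|y|`. Hence `I(C|x - y|) + I(C|y|) ≤ I(C|x|) ≤ 1` when `‖x‖ = 1`
(`modular_sub_add_le`). Under `Δ₂` with `a_φ = 0`, a norm at least `ε` forces a modular at least `η`
(`exists_le_modular_of_le_norm`), and a modular at most `1 - η` forces a norm at most `1 - δ`
(`exists_norm_le_of_modular_le`); both constants are uniform.

(ii) implies (iii) by two counterexamples, each an `x` with minorants `y` bounded away from `0` in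
norm while `‖x - y‖` comes arbitrarily close to `‖x‖`. If `a_φ > 0`, take `x(r) = s/(s+r)²`, so
`Cx(t) = 1/(s+t)`, and let `y` be the part of `x` beyond `T`. For suitable `s`, `T` the norm of `x`
is so large that `Cx/‖x‖` lies below a zero of `φ` beyond `T`; removing `y` then does not lower the
norm. If `Δ₂` fails, choose `φ(2uₙ) > 2ⁿ φ(uₙ)` and let `x` be the supremum of steps of height `uₙ`
and length `mₙ = 1/(2ⁿ φ(uₙ))`. It lies in `L^φ`, hence in `Ces_φ` because `C` preserves `L^φ`. The
tail suprema have norm at least `1/2` but decrease to `0` pointwise, and a Fatou argument brings `‖x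
- y‖` up to `‖x‖`. -/

namespace CesaroOrlicz

/-! ### Elementary consequences of convexity, monotonicity and left continuity. -/

namespace IsOrliczFunction

variable {φ : ℝ≥0 → ℝ≥0∞}

theorem map_mul_le (hφ : IsOrliczFunction φ) {s : ℝ≥0} (hs : s ≤ 1) (u : ℝ≥0) :
    φ (s * u) ≤ s * φ u := by
  have h := hφ.convex.2 (mem_univ u) (mem_univ 0) (zero_le : 0 ≤ s) (zero_le : 0 ≤ 1 - s)
    (add_tsub_cancel_of_le hs)
  simpa [hφ.map_zero, ENNReal.smul_def] using h

/-- Each summand is a fraction of `u + v`, the fractions add up to `1`, and `map_mul_le` applies to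
each. This is the source of uniform monotonicity. -/
theorem map_add_le (hφ : IsOrliczFunction φ) (u v : ℝ≥0) : φ u + φ v ≤ φ (u + v) := by
  rcases eq_or_ne (u + v) 0 with h | h
  · have hu : u = 0 := by simpa using (add_eq_zero.1 h).1
    have hv : v = 0 := by simpa using (add_eq_zero.1 h).2
    simp [hu, hv, hφ.map_zero]
  have key : ∀ w, w ≤ u + v → φ w ≤ (w / (u + v) : ℝ≥0) * φ (u + v) := fun w hw => by
    have := hφ.map_mul_le (s := w / (u + v)) (div_le_one_of_le₀ hw zero_le) (u + v)
    rwa [div_mul_cancel₀ _ h] at this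
  calc φ u + φ v ≤ (u / (u + v) : ℝ≥0) * φ (u + v) + (v / (u + v) : ℝ≥0) * φ (u + v) :=
        add_le_add (key u le_self_add) (key v le_add_self)
    _ = φ (u + v) := by
        rw [← add_mul, ← ENNReal.coe_add, ← add_div, div_self h, ENNReal.coe_one, one_mul]

theorem lt_top_of_bIndex (hφ : IsOrliczFunction φ) (hfin : bIndex φ = ∞) (u : ℝ≥0) :
    φ u < ∞ := by
  have h : (u : ℝ≥0∞) < bIndex φ := hfin ▸ ENNReal.coe_lt_top
  simp only [bIndex, lt_iSup_iff] at h
  obtain ⟨v, hv, huv⟩ := h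
  exact (hφ.mono (ENNReal.coe_lt_coe.1 huv).le).trans_lt hv.2

/-- An Orlicz function dominates a linear function with positive slope for large arguments. -/
theorem exists_mul_le (hφ : IsOrliczFunction φ) :
    ∃ a u₀ : ℝ≥0, 0 < a ∧ 0 < u₀ ∧ ∀ u, u₀ ≤ u → (a * u : ℝ≥0) ≤ φ u := by
  obtain ⟨u₀, hu₀, h⟩ := hφ.not_identically_zero
  obtain ⟨b, hb0, hb⟩ : ∃ b : ℝ≥0, 0 < b ∧ (b : ℝ≥0∞) ≤ φ u₀ := by
    obtain ⟨b, hb0, hb⟩ := ENNReal.lt_iff_exists_nnreal_btwn.1 (pos_iff_ne_zero.2 h)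
    exact ⟨b, by simpa using hb0, hb.le⟩
  refine ⟨b / u₀, u₀, div_pos hb0 hu₀, hu₀, fun u hu => ?_⟩
  have hu' : u ≠ 0 := (hu₀.trans_le hu).ne'
  have h1 := hφ.map_mul_le (s := u₀ / u) (div_le_one_of_le₀ hu zero_le) u
  rw [div_mul_cancel₀ _ hu'] at h1
  have h2 : (b : ℝ≥0∞) ≤ (u₀ / u : ℝ≥0) * φ u := hb.trans h1
  calc ((b / u₀ * u : ℝ≥0) : ℝ≥0∞) = (u / u₀ : ℝ≥0) * (b : ℝ≥0∞) := by
        rw [← ENNReal.coe_mul]; congr 1; field_simp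
    _ ≤ (u / u₀ : ℝ≥0) * ((u₀ / u : ℝ≥0) * φ u) := by gcongr
    _ = φ u := by
        rw [← mul_assoc, ← ENNReal.coe_mul]
        have : u / u₀ * (u₀ / u) = 1 := by field_simp
        simp [this]

theorem exists_lt (hφ : IsOrliczFunction φ) (M : ℝ≥0) :
    ∃ u₀ : ℝ≥0, 0 < u₀ ∧ ∀ u, u₀ ≤ u → M < φ u := by
  obtain ⟨a, u₁, ha, hu₁, h⟩ := hφ.exists_mul_le
  refine ⟨max u₁ ((M + 1) / a), lt_max_of_lt_left hu₁, fun u hu => ?_⟩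
  refine lt_of_lt_of_le ?_ (h u ((le_max_left _ _).trans hu))
  rw [ENNReal.coe_lt_coe]
  have : (M + 1) / a ≤ u := (le_max_right _ _).trans hu
  rw [div_le_iff₀ ha, mul_comm] at this
  exact (lt_add_one M).trans_le this

/-- A finite Orlicz function is arbitrarily small near `0`. -/
theorem exists_le (hφ : IsOrliczFunction φ) (hfin : ∀ u, φ u < ∞) {τ : ℝ≥0} (hτ : 0 < τ) :
    ∃ u : ℝ≥0, 0 < u ∧ φ u ≤ τ := by
  have h1 : φ 1 = ((φ 1).toNNReal : ℝ≥0∞) := (ENNReal.coe_toNNReal (hfin 1).ne).symm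
  set b := (φ 1).toNNReal
  refine ⟨min 1 (τ / (b + 1)), lt_min one_pos (by positivity), ?_⟩
  have h := hφ.map_mul_le (min_le_left 1 (τ / (b + 1))) 1
  rw [mul_one, h1, ← ENNReal.coe_mul] at h
  refine h.trans (ENNReal.coe_le_coe.2 ?_)
  calc min 1 (τ / (b + 1)) * b ≤ τ / (b + 1) * (b + 1) := by
        gcongr
        · exact min_le_right _ _
        · exact le_self_add
    _ = τ := div_mul_cancel₀ _ (by positivity)

/-- Left continuity gives, for each `c < φ u`, a point `w < u` with `c < φ w`; eventually `v n > w`,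
and monotonicity finishes. -/
theorem le_liminf (hφ : IsOrliczFunction φ) {v : ℕ → ℝ≥0} {u : ℝ≥0}
    (hv : Tendsto v atTop (𝓝 u)) : φ u ≤ liminf (fun n => φ (v n)) atTop := by
  rcases eq_or_ne u 0 with rfl | hu
  · simp [hφ.map_zero]
  have hu := pos_iff_ne_zero.2 hu
  refine le_of_forall_lt fun c hc => ?_
  have hne : (𝓝[<] u).NeBot := nhdsLT_neBot_of_exists_lt ⟨0, hu⟩
  obtain ⟨w, hcw, hwu⟩ := (((hφ.left_continuous u hu).eventually (lt_mem_nhds hc)).and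
    self_mem_nhdsWithin).exists
  refine hcw.trans_le (le_liminf_of_le (by isBoundedDefault) ?_)
  filter_upwards [hv.eventually (lt_mem_nhds hwu)] with n hn using hφ.mono hn.le

theorem map_pos_of_aIndex (h : aIndex φ = 0) {u : ℝ≥0} (hu : 0 < u) : 0 < φ u := by
  rw [pos_iff_ne_zero]
  intro h0
  have : (u : ℝ≥0∞) ≤ aIndex φ := le_iSup₂_of_le u h0 le_rfl
  rw [h] at this
  exact hu.ne' (by simpa using this)

theorem exists_zero_of_aIndex (h : aIndex φ ≠ 0) : ∃ a : ℝ≥0, 0 < a ∧ φ a = 0 := by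
  by_contra! hc
  refine h ?_
  simp only [aIndex, ENNReal.iSup_eq_zero]
  intro u hu
  by_contra h0
  exact hc u (pos_iff_ne_zero.2 (by simpa using h0)) hu

end IsOrliczFunction

/-! ### The modular -/

variable {I : Interval} {φ : ℝ≥0 → ℝ≥0∞}

theorem modular_mono (hφ : IsOrliczFunction φ) {f g : ℝ → ℝ}
    (h : ∀ᵐ t ∂I.measure, |f t| ≤ |g t|) : modular I φ f ≤ modular I φ g := by
  refine lintegral_mono_ae ?_
  filter_upwards [h] with t ht
  exact hφ.mono (NNReal.coe_le_coe.1 (by simpa using ht))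

theorem modular_congr {f g : ℝ → ℝ} (h : f =ᵐ[I.measure] g) :
    modular I φ f = modular I φ g := by
  refine lintegral_congr_ae ?_
  filter_upwards [h] with t ht
  rw [ht]

theorem modular_const_mul_le (hφ : IsOrliczFunction φ) {s : ℝ≥0} (hs : s ≤ 1) (f : ℝ → ℝ) :
    modular I φ (fun t => s * f t) ≤ s * modular I φ f := by
  rw [modular, modular, ← lintegral_const_mul' _ _ ENNReal.coe_ne_top]
  refine lintegral_mono fun t => ?_
  have : ‖(s : ℝ) * f t‖₊ = s * ‖f t‖₊ := by rw [nnnorm_mul]; simp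
  rw [this]
  exact hφ.map_mul_le hs _

theorem aemeasurable_comp (hφ : IsOrliczFunction φ) {μ : Measure ℝ} {f : ℝ → ℝ}
    (hf : AEMeasurable f μ) : AEMeasurable (fun t => φ ‖f t‖₊) μ :=
  hφ.mono.measurable.comp_aemeasurable hf.nnnorm

/-- Lower semicontinuity of the modular with respect to convergence almost everywhere. -/
theorem modular_le_of_tendsto (hφ : IsOrliczFunction φ) {F : ℕ → ℝ → ℝ} {f : ℝ → ℝ} {c : ℝ≥0∞}
    (hF : ∀ n, AEMeasurable (F n) I.measure)
    (h : ∀ᵐ t ∂I.measure, Tendsto (fun n => F n t) atTop (𝓝 (f t)))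
    (hc : ∀ n, modular I φ (F n) ≤ c) : modular I φ f ≤ c := by
  calc modular I φ f ≤ ∫⁻ t, liminf (fun n => φ ‖F n t‖₊) atTop ∂I.measure := by
        refine lintegral_mono_ae ?_
        filter_upwards [h] with t ht using hφ.le_liminf ht.nnnorm
    _ ≤ liminf (fun n => modular I φ (F n)) atTop :=
        lintegral_liminf_le' fun n => aemeasurable_comp hφ (hF n)
    _ ≤ c := by
        refine (liminf_le_liminf (Eventually.of_forall hc)).trans ?_
        simp

/-- The modular of a function that is at least `β` on a subset of measure `m` is at least
`m φ(β)`. -/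
theorem mul_le_modular (hφ : IsOrliczFunction φ) {f : ℝ → ℝ} {A : Set ℝ} (hA : MeasurableSet A)
    {β : ℝ≥0} (h : ∀ t ∈ A, (β : ℝ) ≤ |f t|) : φ β * I.measure A ≤ modular I φ f := by
  calc φ β * I.measure A = ∫⁻ t in A, φ β ∂I.measure := by simp
    _ ≤ ∫⁻ t in A, φ ‖f t‖₊ ∂I.measure :=
        setLIntegral_mono' hA fun t ht => hφ.mono (NNReal.coe_le_coe.1 (by simpa using h t ht))
    _ ≤ modular I φ f := setLIntegral_le_lintegral _ _

/-! ### The Orlicz norm -/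

theorem orlicz_bddBelow (f : ℝ → ℝ) :
    BddBelow {c : ℝ | 0 < c ∧ modular I φ (fun t => f t / c) ≤ 1} :=
  ⟨0, fun _ hc => hc.1.le⟩

theorem orlicz_norm_le {f : ℝ → ℝ} {c : ℝ} (hc : 0 < c)
    (h : modular I φ (fun t => f t / c) ≤ 1) : (orliczSpace I φ).norm f ≤ c :=
  csInf_le (orlicz_bddBelow f) ⟨hc, h⟩

theorem modular_div_anti (hφ : IsOrliczFunction φ) (f : ℝ → ℝ) {c d : ℝ} (hc : 0 < c)
    (hcd : c ≤ d) : modular I φ (fun t => f t / d) ≤ modular I φ (fun t => f t / c) := by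
  refine modular_mono hφ (Eventually.of_forall fun t => ?_)
  rw [abs_div, abs_div, abs_of_pos hc, abs_of_pos (hc.trans_le hcd)]
  gcongr

/-- With `M` the finite modular at scale `c`, convexity bounds the modular at scale `c (M + 1)` by
`M / (M + 1)`. Nonemptiness matters because the real infimum of the empty set is `0`, which would
spoil lower bounds on the norm. -/
theorem orlicz_set_nonempty (hφ : IsOrliczFunction φ) {f : ℝ → ℝ}
    (hf : f ∈ (orliczSpace I φ).carrier) :
    {c : ℝ | 0 < c ∧ modular I φ (fun t => f t / c) ≤ 1}.Nonempty := by
  obtain ⟨-, c, hc, h⟩ := hf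
  set M := (modular I φ fun t => f t / c).toNNReal with hM
  have hM' : modular I φ (fun t => f t / c) = M := (ENNReal.coe_toNNReal h.ne).symm
  refine ⟨c * (M + 1), by positivity, ?_⟩
  have h1 := modular_const_mul_le (I := I) hφ (s := (M + 1)⁻¹)
    (inv_le_one_of_one_le₀ (le_add_self)) (fun t => f t / c)
  have h2 : (fun t => f t / (c * (M + 1))) = fun t => (((M + 1)⁻¹ : ℝ≥0) : ℝ) * (f t / c) := by
    ext t; push_cast; field_simp
  rw [h2]
  refine h1.trans ?_
  rw [hM', ← ENNReal.coe_mul, ← ENNReal.coe_one, ENNReal.coe_le_coe, inv_mul_le_iff₀ (by positivity)]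
  simp

theorem modular_le_one_of_norm_lt (hφ : IsOrliczFunction φ) {f : ℝ → ℝ}
    (hf : f ∈ (orliczSpace I φ).carrier) {c : ℝ} (h : (orliczSpace I φ).norm f < c) :
    modular I φ (fun t => f t / c) ≤ 1 := by
  obtain ⟨d, ⟨hd, hd1⟩, hdc⟩ := exists_lt_of_csInf_lt (orlicz_set_nonempty hφ hf) h
  exact (modular_div_anti hφ f hd hdc.le).trans hd1

theorem le_orlicz_norm (hφ : IsOrliczFunction φ) {f : ℝ → ℝ}
    (hf : f ∈ (orliczSpace I φ).carrier) {c : ℝ}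
    (h : 1 < modular I φ (fun t => f t / c)) : c ≤ (orliczSpace I φ).norm f := by
  by_contra! hlt
  exact h.not_ge (modular_le_one_of_norm_lt hφ hf hlt)

/-- The infimum is attained: let the scales `1 + 1/(n+1)` decrease to `1` and use lower
semicontinuity of the modular. -/
theorem modular_le_one_of_norm_eq_one (hφ : IsOrliczFunction φ) {f : ℝ → ℝ}
    (hf : f ∈ (orliczSpace I φ).carrier) (h : (orliczSpace I φ).norm f = 1) :
    modular I φ f ≤ 1 := by
  have hlim : Tendsto (fun n : ℕ => 1 + 1 / ((n : ℝ) + 1)) atTop (𝓝 1) := by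
    simpa using tendsto_const_nhds.add (tendsto_one_div_add_atTop_nhds_zero_nat (𝕜 := ℝ))
  refine modular_le_of_tendsto hφ (F := fun n t => f t / (1 + 1 / ((n : ℝ) + 1)))
    (fun n => hf.1.div_const _) (Eventually.of_forall fun t => ?_) fun n => ?_
  · simpa [Pi.div_def] using (tendsto_const_nhds (x := f t)).div hlim one_ne_zero
  · refine modular_le_one_of_norm_lt hφ hf ?_
    rw [h]
    have : (0 : ℝ) < 1 / ((n : ℝ) + 1) := by positivity
    linarith

open scoped Pointwise in
theorem orlicz_norm_div {c : ℝ} (hc : 0 < c) (f : ℝ → ℝ) :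
    (orliczSpace I φ).norm (fun t => f t / c) = (orliczSpace I φ).norm f / c := by
  have : {d : ℝ | 0 < d ∧ modular I φ (fun t => f t / c / d) ≤ 1}
      = c⁻¹ • {d : ℝ | 0 < d ∧ modular I φ (fun t => f t / d) ≤ 1} := by
    ext d
    rw [mem_smul_set_iff_inv_smul_mem₀ (inv_ne_zero hc.ne')]
    simp only [mem_ofPred_eq, inv_inv, smul_eq_mul, div_div, mul_pos_iff_of_pos_left hc]
  change sInf _ = sInf _ / c
  rw [this, Real.sInf_smul_of_nonneg (by positivity), smul_eq_mul, inv_mul_eq_div]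

theorem orlicz_norm_congr {f g : ℝ → ℝ} (h : f =ᵐ[I.measure] g) :
    (orliczSpace I φ).norm f = (orliczSpace I φ).norm g := by
  have : ∀ c : ℝ, modular I φ (fun t => f t / c) = modular I φ (fun t => g t / c) := fun c =>
    modular_congr (by filter_upwards [h] with t ht; rw [ht])
  simp only [orliczSpace, this]

theorem mem_orlicz_div {c : ℝ} (hc : 0 < c) {f : ℝ → ℝ} (hf : f ∈ (orliczSpace I φ).carrier) :
    (fun t => f t / c) ∈ (orliczSpace I φ).carrier := by
  obtain ⟨h1, d, hd, h⟩ := hf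
  refine ⟨h1.div_const _, d / c, by positivity, ?_⟩
  convert h using 3 with t
  field_simp

theorem mem_orlicz_of_le (hφ : IsOrliczFunction φ) {f g : ℝ → ℝ}
    (hg : g ∈ (orliczSpace I φ).carrier) (hf : AEMeasurable f I.measure)
    (h : ∀ᵐ t ∂I.measure, |f t| ≤ |g t|) : f ∈ (orliczSpace I φ).carrier := by
  obtain ⟨-, c, hc, hgc⟩ := hg
  refine ⟨hf, c, hc, (modular_mono hφ ?_).trans_lt hgc⟩
  filter_upwards [h] with t ht
  rw [abs_div, abs_div]
  gcongr

/-! ### The Cesàro operator -/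

theorem Interval.measurableSet_toSet (I : Interval) : MeasurableSet I.toSet := by
  cases I
  exacts [measurableSet_Icc, measurableSet_Ici]

theorem Interval.nonneg_of_mem {t : ℝ} (ht : t ∈ I.toSet) : 0 ≤ t := by
  cases I
  exacts [ht.1, ht]

theorem Interval.Ioc_subset {t : ℝ} (ht : t ∈ I.toSet) : Ioc 0 t ⊆ I.toSet := by
  cases I
  · exact fun s hs => ⟨hs.1.le, hs.2.trans ht.2⟩
  · exact fun s hs => hs.1.le

theorem Interval.ae_mem (I : Interval) : ∀ᵐ t ∂I.measure, t ∈ I.toSet :=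
  ae_restrict_mem I.measurableSet_toSet

theorem Interval.ae_pos (I : Interval) : ∀ᵐ t ∂I.measure, 0 < t := by
  have h0 : ∀ᵐ t : ℝ ∂I.measure, t ≠ 0 := ae_restrict_of_ae (Measure.ae_ne volume 0)
  filter_upwards [I.ae_mem, h0] with t ht h using (nonneg_of_mem ht).lt_of_ne' h

theorem Interval.ae_restrict_Ioc {t : ℝ} (ht : t ∈ I.toSet) {p : ℝ → Prop}
    (h : ∀ᵐ s ∂I.measure, p s) : ∀ᵐ s ∂volume.restrict (Ioc 0 t), p s :=
  ae_mono (Measure.restrict_mono (Interval.Ioc_subset ht) le_rfl) h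

theorem cesaro_abs_nonneg (f : ℝ → ℝ) {t : ℝ} (ht : 0 ≤ t) : 0 ≤ cesaro (fun s => |f s|) t :=
  mul_nonneg (by positivity) (intervalIntegral.integral_nonneg ht fun _ _ => abs_nonneg _)

theorem cesaro_mono {f g : ℝ → ℝ} {t : ℝ} (ht : t ∈ I.toSet)
    (hf : IntervalIntegrable f volume 0 t) (hg : IntervalIntegrable g volume 0 t)
    (h : ∀ᵐ s ∂I.measure, f s ≤ g s) : cesaro f t ≤ cesaro g t := by
  have h0 := Interval.nonneg_of_mem ht
  refine mul_le_mul_of_nonneg_left ?_ (by positivity)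
  have hle := Interval.ae_restrict_Ioc ht h
  rw [restrict_Ioc_eq_restrict_Icc] at hle
  exact intervalIntegral.integral_mono_ae_restrict h0 hf hg hle

theorem cesaro_abs_sub_ae {x y : ℝ → ℝ}
    (hx : ∀ᵐ t ∂I.measure, IntervalIntegrable (fun s => |x s|) volume 0 t)
    (hy : ∀ᵐ t ∂I.measure, IntervalIntegrable (fun s => |y s|) volume 0 t)
    (h0 : 0 ≤ᵐ[I.measure] y) (hxy : y ≤ᵐ[I.measure] x) :
    cesaro (fun s => |(x - y) s|) =ᵐ[I.measure]
      cesaro (fun s => |x s|) - cesaro (fun s => |y s|) := by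
  filter_upwards [I.ae_mem, hx, hy] with t ht hxt hyt
  have h0t := Interval.nonneg_of_mem ht
  rw [Pi.sub_apply, cesaro, cesaro, cesaro, ← mul_sub, ← intervalIntegral.integral_sub hxt hyt]
  congr 1
  refine intervalIntegral.integral_congr_ae_restrict ?_
  rw [uIoc_of_le h0t]
  filter_upwards [Interval.ae_restrict_Ioc ht h0, Interval.ae_restrict_Ioc ht hxy] with s h1 h2
  have h1 : 0 ≤ y s := h1
  rw [Pi.sub_apply, abs_of_nonneg h1, abs_of_nonneg (h1.trans h2), abs_of_nonneg (sub_nonneg.2 h2)]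

theorem cesaro_abs_div (f : ℝ → ℝ) {c : ℝ} (hc : 0 < c) :
    cesaro (fun s => |f s / c|) = fun t => cesaro (fun s => |f s|) t / c := by
  ext t
  simp only [cesaro, abs_div, abs_of_pos hc, intervalIntegral.integral_div, mul_div_assoc]

theorem mem_cesaro_div {c : ℝ} (hc : 0 < c) {f : ℝ → ℝ}
    (hf : f ∈ (cesaroOrliczSpace I φ).carrier) :
    (fun t => f t / c) ∈ (cesaroOrliczSpace I φ).carrier := by
  obtain ⟨h1, h2, h3⟩ := hf
  refine ⟨h1.div_const _, ?_, ?_⟩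
  · filter_upwards [h2] with t ht
    simpa only [abs_div, abs_of_pos hc] using ht.div_const c
  · rw [cesaro_abs_div f hc]
    exact mem_orlicz_div hc h3

theorem cesaro_norm_div {c : ℝ} (hc : 0 < c) (f : ℝ → ℝ) :
    (cesaroOrliczSpace I φ).norm (fun t => f t / c) = (cesaroOrliczSpace I φ).norm f / c := by
  change (orliczSpace I φ).norm _ = (orliczSpace I φ).norm _ / c
  rw [cesaro_abs_div f hc, orlicz_norm_div hc]

/-! ### Sufficiency of the condition `Δ₂` -/

/-- Between `u₁` and `u₀` the quotient `φ(2u)/φ(u)` is at most `φ(2u₀)/φ(u₁)`, which is finite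
because `a_φ = 0`; so the threshold in `Δ₂` can be any positive number. -/
theorem exists_map_two_mul_le_of_large (hφ : IsOrliczFunction φ) (hfin : ∀ u, φ u < ∞)
    (ha : aIndex φ = 0) (h : DeltaTwoLarge φ) {u₁ : ℝ≥0} (hu₁ : 0 < u₁) :
    ∃ K : ℝ≥0, 0 < K ∧ ∀ u, u₁ ≤ u → φ (2 * u) ≤ K * φ u := by
  obtain ⟨K, u₀, hK, -, -, hK2⟩ := h
  have hpos := IsOrliczFunction.map_pos_of_aIndex ha hu₁
  set p := (φ u₁).toNNReal
  have hp : φ u₁ = p := (ENNReal.coe_toNNReal (hfin _).ne).symm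
  set q := (φ (2 * u₀)).toNNReal
  have hq : φ (2 * u₀) = q := (ENNReal.coe_toNNReal (hfin _).ne).symm
  have hp0 : 0 < p := by simpa [hp] using hpos
  refine ⟨max K (q / p), lt_max_of_lt_left hK, fun u hu => ?_⟩
  rcases le_total u₀ u with h0 | h0
  · refine (hK2 u h0).trans ?_
    gcongr
    exact le_max_left _ _
  · calc φ (2 * u) ≤ φ (2 * u₀) := hφ.mono (by gcongr)
      _ = (q / p : ℝ≥0) * p := by rw [hq, ← ENNReal.coe_mul, div_mul_cancel₀ _ hp0.ne']
      _ ≤ (max K (q / p) : ℝ≥0) * φ u := by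
        gcongr
        · exact le_max_right _ _
        · rw [← hp]; exact hφ.mono hu

/-- The error `τ` is needed only on `[0,1]`: where `|f|` is below the chosen threshold, `φ(2|f|) ≤
τ`, and the interval has measure `1`. -/
theorem exists_modular_two_mul_le (hφ : IsOrliczFunction φ) (hfin : ∀ u, φ u < ∞)
    (ha : aIndex φ = 0) (h : DeltaTwo I φ) {τ : ℝ≥0} (hτ : 0 < τ) :
    ∃ K : ℝ≥0, ∀ f : ℝ → ℝ, modular I φ (fun t => 2 * f t) ≤ τ + K * modular I φ f := by
  have hn : ∀ f : ℝ → ℝ, ∀ t, ‖2 * f t‖₊ = 2 * ‖f t‖₊ := fun f t => by simp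
  cases I with
  | halfLine =>
    obtain ⟨K, -, hK⟩ := h
    refine ⟨K, fun f => le_add_left ?_⟩
    rw [modular, modular, ← lintegral_const_mul' _ _ ENNReal.coe_ne_top]
    refine lintegral_mono fun t => ?_
    rw [hn]
    exact hK _
  | unit =>
    obtain ⟨v, hv, hvτ⟩ := hφ.exists_le hfin hτ
    obtain ⟨K, -, hK⟩ := exists_map_two_mul_le_of_large hφ hfin ha h (half_pos hv)
    refine ⟨K, fun f => ?_⟩
    calc modular .unit φ (fun t => 2 * f t)
        ≤ ∫⁻ t, ((τ : ℝ≥0∞) + K * φ ‖f t‖₊) ∂Interval.unit.measure := by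
          refine lintegral_mono fun t => ?_
          rw [hn]
          rcases le_total (v / 2) ‖f t‖₊ with h1 | h1
          · exact le_add_left (hK _ h1)
          · refine le_add_right ((hφ.mono ?_).trans hvτ)
            rwa [le_div_iff₀' two_pos] at h1
      _ = τ + K * modular .unit φ f := by
          rw [lintegral_add_left measurable_const, lintegral_const_mul' _ _ ENNReal.coe_ne_top]
          simp [Interval.measure, Interval.toSet, modular]

theorem exists_modular_two_pow_mul_le (hφ : IsOrliczFunction φ) (hfin : ∀ u, φ u < ∞)
    (ha : aIndex φ = 0) (h : DeltaTwo I φ) (k : ℕ) {τ : ℝ≥0} (hτ : 0 < τ) :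
    ∃ K : ℝ≥0, ∀ f : ℝ → ℝ, modular I φ (fun t => 2 ^ k * f t) ≤ τ + K * modular I φ f := by
  induction k generalizing τ with
  | zero => exact ⟨1, fun f => by simp⟩
  | succ k ih =>
    obtain ⟨K₁, h₁⟩ := exists_modular_two_mul_le hφ hfin ha h (half_pos hτ)
    -- This error is later multiplied by `K₁`, and must then still be at most `τ / 2`.
    obtain ⟨K₂, h₂⟩ := ih (τ := τ / 2 / (K₁ + 1)) (by positivity)
    refine ⟨K₁ * K₂, fun f => ?_⟩
    have e : (fun t => 2 ^ (k + 1) * f t) = fun t => 2 * (2 ^ k * f t) := by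
      ext t; ring
    rw [e]
    calc _ ≤ ((τ / 2 : ℝ≥0) : ℝ≥0∞) + K₁ * modular I φ (fun t => 2 ^ k * f t) := h₁ _
      _ ≤ ((τ / 2 : ℝ≥0) : ℝ≥0∞) + K₁ * ((τ / 2 / (K₁ + 1) : ℝ≥0) + K₂ * modular I φ f) := by
          gcongr
          exact h₂ f
      _ = (((τ / 2 : ℝ≥0) + K₁ * (τ / 2 / (K₁ + 1)) : ℝ≥0) : ℝ≥0∞)
            + (K₁ * K₂ : ℝ≥0) * modular I φ f := by
          push_cast
          ring
      _ ≤ τ + (K₁ * K₂ : ℝ≥0) * modular I φ f := by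
          gcongr
          calc τ / 2 + K₁ * (τ / 2 / (K₁ + 1)) ≤ τ / 2 + (K₁ + 1) * (τ / 2 / (K₁ + 1)) := by
                gcongr
                exact le_self_add
            _ = τ := by rw [mul_div_cancel₀ _ (by positivity), add_halves]

/-- Under the condition `Δ₂` the modular of a function is bounded below in terms of its norm. -/
theorem exists_le_modular_of_le_norm (hφ : IsOrliczFunction φ) (hfin : ∀ u, φ u < ∞)
    (ha : aIndex φ = 0) (h : DeltaTwo I φ) {ε : ℝ} (hε : 0 < ε) :
    ∃ η : ℝ≥0, 0 < η ∧ ∀ f : ℝ → ℝ, ε ≤ (orliczSpace I φ).norm f → η ≤ modular I φ f := by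
  obtain ⟨k, hk⟩ := exists_pow_lt_of_lt_one hε (by norm_num : (1 / 2 : ℝ) < 1)
  obtain ⟨K, hK⟩ := exists_modular_two_pow_mul_le hφ hfin ha h k (τ := 1 / 2) (by positivity)
  -- A smaller modular would give `I(2ᵏ f) ≤ 1/2 + 1/2`, hence norm at most `2⁻ᵏ < ε`.
  refine ⟨1 / 2 / (K + 1), by positivity, fun f hf => ?_⟩
  by_contra! hlt
  refine hk.not_ge (hf.trans (orlicz_norm_le (by positivity) ?_))
  have e : (fun t => f t / (1 / 2 : ℝ) ^ k) = fun t => 2 ^ k * f t := by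
    ext t
    rw [one_div, inv_pow, div_inv_eq_mul, mul_comm]
  rw [e]
  calc _ ≤ ((1 / 2 : ℝ≥0) : ℝ≥0∞) + K * modular I φ f := hK f
    _ ≤ ((1 / 2 : ℝ≥0) : ℝ≥0∞) + (K + 1 : ℝ≥0) * (1 / 2 / (K + 1) : ℝ≥0) := by
        gcongr
        exact le_self_add
    _ = 1 := by
        rw [← ENNReal.coe_mul, mul_div_cancel₀ _ (by positivity), ← ENNReal.coe_add, add_halves,
          ENNReal.coe_one]

/-- Under the condition `Δ₂` the norm of a function with modular less than `1` is less than `1`,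
uniformly. -/
theorem exists_norm_le_of_modular_le (hφ : IsOrliczFunction φ) (hfin : ∀ u, φ u < ∞)
    (ha : aIndex φ = 0) (h : DeltaTwo I φ) {η : ℝ≥0} (hη : 0 < η) :
    ∃ δ ∈ Ioo (0 : ℝ) 1, ∀ f : ℝ → ℝ, AEMeasurable f I.measure → modular I φ f + η ≤ 1 →
      (orliczSpace I φ).norm f ≤ 1 - δ := by
  obtain ⟨K, hK⟩ := exists_modular_two_mul_le hφ hfin ha h (τ := 1) one_pos
  set M := 1 + K with hM
  -- Since `(1 + t) f = (1 - t) f + t (2f)`, convexity gives `I((1 + t) f) ≤ I(f) + t I(2f) ≤ I(f) +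
  -- t M`, and `t M ≤ η`. The resulting norm bound `1/(1 + t)` is `1 - δ` with `δ = t/(1 + t)`.
  set t := min 1 (η / M) with ht
  have ht0 : 0 < t := lt_min one_pos (by positivity)
  have ht1 : t ≤ 1 := min_le_left _ _
  have htM : t * M ≤ η := (le_div_iff₀ (by positivity)).1 (min_le_right _ _)
  have ht0' : (0 : ℝ) < t := ht0
  refine ⟨t / (1 + t), ⟨by positivity, ?_⟩, fun f hf hfη => ?_⟩
  · rw [div_lt_one (by positivity)]; linarith
  have e1 : (1 : ℝ) - t / (1 + t) = 1 / (1 + t) := by field_simp; ring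
  rw [e1]
  refine orlicz_norm_le (by positivity) ?_
  have hle : modular I φ f ≤ 1 := le_self_add.trans hfη
  have h2 : modular I φ (fun s => 2 * f s) ≤ M := by
    refine (hK f).trans ?_
    calc ((1 : ℝ≥0) : ℝ≥0∞) + K * modular I φ f ≤ (1 : ℝ≥0) + K * 1 := by gcongr
      _ = M := by simp [hM]
  calc modular I φ (fun s => f s / (1 / (1 + t)))
      ≤ ∫⁻ s, (φ ‖f s‖₊ + t * φ ‖2 * f s‖₊) ∂I.measure := by
        refine lintegral_mono fun s => ?_
        have e2 : ‖f s / (1 / (1 + (t : ℝ)))‖₊ = (1 - t) * ‖f s‖₊ + t * ‖2 * f s‖₊ := by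
          rw [← NNReal.coe_inj]
          push_cast [NNReal.coe_sub ht1]
          rw [norm_div, norm_div, norm_mul, Real.norm_of_nonneg (by positivity : 0 ≤ 1 + (t : ℝ))]
          norm_num
          ring
        rw [e2]
        have := hφ.convex.2 (mem_univ ‖f s‖₊) (mem_univ ‖2 * f s‖₊)
          (zero_le : 0 ≤ 1 - t) (zero_le : 0 ≤ t) (tsub_add_cancel_of_le ht1)
        simp only [smul_eq_mul, ENNReal.smul_def] at this
        refine this.trans (add_le_add ?_ le_rfl)
        exact mul_le_of_le_one_left' (by exact_mod_cast tsub_le_self)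
    _ = modular I φ f + t * modular I φ (fun s => 2 * f s) := by
        rw [lintegral_add_left' (aemeasurable_comp hφ hf), lintegral_const_mul' _ _
          ENNReal.coe_ne_top, modular, modular]
    _ ≤ modular I φ f + t * M := by gcongr
    _ ≤ modular I φ f + η := by gcongr; exact_mod_cast htM
    _ ≤ 1 := hfη

theorem modular_sub_add_le (hφ : IsOrliczFunction φ) {f g : ℝ → ℝ} (hg : AEMeasurable g I.measure)
    (h0 : ∀ᵐ t ∂I.measure, 0 ≤ g t) (h : ∀ᵐ t ∂I.measure, g t ≤ f t) :
    modular I φ (f - g) + modular I φ g ≤ modular I φ f := by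
  rw [modular, modular, ← lintegral_add_right' _ (aemeasurable_comp hφ hg)]
  refine lintegral_mono_ae ?_
  filter_upwards [h0, h] with t h1 h2
  refine (hφ.map_add_le _ _).trans (hφ.mono ?_)
  rw [← NNReal.coe_le_coe]
  push_cast
  rw [Pi.sub_apply, Real.norm_of_nonneg h1, Real.norm_of_nonneg (h1.trans h2),
    Real.norm_of_nonneg (sub_nonneg.2 h2), sub_add_cancel]

theorem uniformlyMonotone_of_deltaTwo (hφ : IsOrliczFunction φ) (hfin : ∀ u, φ u < ∞)
    (ha : aIndex φ = 0) (h : DeltaTwo I φ) : UniformlyMonotone I (cesaroOrliczSpace I φ) := by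
  intro ε hε
  obtain ⟨η, hη, H1⟩ := exists_le_modular_of_le_norm hφ hfin ha h hε.1
  obtain ⟨δ, hδ, H2⟩ := exists_norm_le_of_modular_le hφ hfin ha h hη
  refine ⟨δ, hδ, fun x hx y hy h0 hxy hnx hny => ?_⟩
  obtain ⟨hx1, hx2, hx3⟩ := hx
  obtain ⟨hy1, hy2, hy3⟩ := hy
  change (orliczSpace I φ).norm _ ≤ _
  rw [orlicz_norm_congr (cesaro_abs_sub_ae hx2 hy2 h0 hxy)]
  refine H2 _ (hx3.1.sub hy3.1) ?_
  calc _ ≤ modular I φ (cesaro (fun s => |x s|) - cesaro (fun s => |y s|))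
          + modular I φ (cesaro (fun s => |y s|)) := by gcongr; exact H1 _ hny
    _ ≤ modular I φ (cesaro (fun s => |x s|)) := by
        refine modular_sub_add_le hφ hy3.1 ?_ ?_
        · filter_upwards [I.ae_mem] with t ht
            using cesaro_abs_nonneg y (Interval.nonneg_of_mem ht)
        · filter_upwards [I.ae_mem, hx2, hy2] with t ht hxt hyt
          refine cesaro_mono ht hyt hxt ?_
          filter_upwards [h0, hxy] with s h1 h2
          exact abs_le_abs_of_nonneg h1 h2
    _ ≤ 1 := modular_le_one_of_norm_eq_one hφ hx3 hnx

/-! ### Further properties of Cesàro-Orlicz spaces -/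

theorem Interval.measure_Ioc {p q : ℝ} (hp : 0 ≤ p) (hq : q ∈ I.toSet) :
    I.measure (Ioc p q) = ENNReal.ofReal (q - p) := by
  rw [Interval.measure, Measure.restrict_apply measurableSet_Ioc, inter_eq_left.2, Real.volume_Ioc]
  exact (Ioc_subset_Ioc_left hp).trans (Interval.Ioc_subset hq)

theorem Interval.measure_Iic_le (m : ℝ) : I.measure (Iic m) ≤ ENNReal.ofReal m := by
  rw [Interval.measure, Measure.restrict_apply measurableSet_Iic]
  calc volume (Iic m ∩ I.toSet) ≤ volume (Icc 0 m) :=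
        measure_mono fun t ht => ⟨Interval.nonneg_of_mem ht.2, ht.1⟩
    _ = ENNReal.ofReal m := by simp

/-- On the interval, `Cf(t)` is `1/t` times the integral over `s` of a jointly measurable function
of `(t, s)`, supported on `0 < s ≤ t`. -/
theorem aemeasurable_cesaro {f : ℝ → ℝ} (hf : AEMeasurable f I.measure) :
    AEMeasurable (cesaro f) I.measure := by
  have hS : MeasurableSet {z : ℝ × ℝ | 0 < z.2 ∧ z.2 ≤ z.1} :=
    (measurableSet_lt measurable_const measurable_snd).inter
      (measurableSet_le measurable_snd measurable_fst)
  have hF : StronglyMeasurable fun z : ℝ × ℝ =>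
      {z : ℝ × ℝ | 0 < z.2 ∧ z.2 ≤ z.1}.indicator (fun z => hf.mk f z.2) z :=
    ((hf.measurable_mk.comp measurable_snd).indicator hS).stronglyMeasurable
  have hG : Measurable fun t : ℝ => (1 / t) * ∫ s,
      {z : ℝ × ℝ | 0 < z.2 ∧ z.2 ≤ z.1}.indicator (fun z => hf.mk f z.2) (t, s) :=
    (measurable_const.div measurable_id).mul hF.integral_prod_right.measurable
  refine ⟨_, hG, ?_⟩
  filter_upwards [I.ae_mem] with t ht
  rw [cesaro, intervalIntegral.integral_of_le (Interval.nonneg_of_mem ht),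
    integral_congr_ae (Interval.ae_restrict_Ioc ht hf.ae_eq_mk),
    ← integral_indicator measurableSet_Ioc]
  rfl

theorem mem_cesaro_of_le (hφ : IsOrliczFunction φ) {x y : ℝ → ℝ}
    (hx : x ∈ (cesaroOrliczSpace I φ).carrier) (hy : AEMeasurable y I.measure)
    (h : ∀ᵐ t ∂I.measure, |y t| ≤ |x t|) : y ∈ (cesaroOrliczSpace I φ).carrier := by
  obtain ⟨-, hx2, hx3⟩ := hx
  have hint : ∀ᵐ t ∂I.measure, IntervalIntegrable (fun s => |y s|) volume 0 t := by
    filter_upwards [I.ae_mem, hx2] with t ht hxt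
    have hle := Interval.ae_restrict_Ioc ht h
    rw [intervalIntegrable_iff_integrableOn_Ioc_of_le (Interval.nonneg_of_mem ht)] at hxt ⊢
    refine Integrable.mono' hxt ?_ (by simpa using hle)
    exact (hy.mono_measure (Measure.restrict_mono (Interval.Ioc_subset ht)
      le_rfl)).abs.aestronglyMeasurable
  have habs : AEMeasurable (fun t => |y t|) I.measure := hy.abs
  refine ⟨hy, hint, mem_orlicz_of_le hφ hx3 (aemeasurable_cesaro habs) ?_⟩
  filter_upwards [I.ae_mem, hx2, hint] with t ht h1 h2
  have h0 := Interval.nonneg_of_mem ht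
  rw [abs_of_nonneg (cesaro_abs_nonneg _ h0), abs_of_nonneg (cesaro_abs_nonneg _ h0)]
  exact cesaro_mono ht h2 h1 h

/-- Functions in an Orlicz space are integrable on bounded intervals. -/
theorem intervalIntegrable_of_mem_orlicz (hφ : IsOrliczFunction φ) {f : ℝ → ℝ}
    (hf : f ∈ (orliczSpace I φ).carrier) {t : ℝ} (ht : t ∈ I.toSet) :
    IntervalIntegrable f volume 0 t := by
  obtain ⟨hm, c, hc, hfc⟩ := hf
  obtain ⟨a, u₀, ha, -, h⟩ := hφ.exists_mul_le
  rw [intervalIntegrable_iff_integrableOn_Ioc_of_le (Interval.nonneg_of_mem ht)]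
  have hsub : volume.restrict (Ioc 0 t) ≤ I.measure :=
    Measure.restrict_mono (Interval.Ioc_subset ht) le_rfl
  have hle : ∀ v : ℝ≥0, (v : ℝ≥0∞) ≤ u₀ + (a⁻¹ : ℝ≥0) * φ v := fun v => by
    rcases le_total v u₀ with h1 | h1
    · exact le_add_right (by exact_mod_cast h1)
    · refine le_add_left ?_
      calc (v : ℝ≥0∞) = (a⁻¹ : ℝ≥0) * (a * v : ℝ≥0) := by
            rw [← ENNReal.coe_mul, inv_mul_cancel_left₀ ha.ne']
        _ ≤ (a⁻¹ : ℝ≥0) * φ v := by gcongr; exact h v h1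
  have hfin : Integrable (fun s => f s / c) (volume.restrict (Ioc 0 t)) := by
    refine ⟨((hm.div_const c).mono_measure hsub).aestronglyMeasurable, ?_⟩
    calc ∫⁻ s in Ioc 0 t, ‖f s / c‖ₑ
        ≤ ∫⁻ s in Ioc 0 t, ((u₀ : ℝ≥0∞) + (a⁻¹ : ℝ≥0) * φ ‖f s / c‖₊) :=
          lintegral_mono fun s => hle _
      _ = u₀ * volume (Ioc 0 t) + (a⁻¹ : ℝ≥0) * ∫⁻ s in Ioc 0 t, φ ‖f s / c‖₊ := by
          rw [lintegral_add_left measurable_const, lintegral_const_mul' _ _ ENNReal.coe_ne_top]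
          simp
      _ ≤ u₀ * volume (Ioc 0 t) + (a⁻¹ : ℝ≥0) * modular I φ (fun s => f s / c) := by
          gcongr
          exact lintegral_mono' hsub le_rfl
      _ < ∞ := by
          refine ENNReal.add_lt_top.2 ⟨ENNReal.mul_lt_top ENNReal.coe_lt_top (by simp),
            ENNReal.mul_lt_top ENNReal.coe_lt_top hfc⟩
  have := hfin.mul_const c
  simpa [IntegrableOn, div_mul_cancel₀ _ hc.ne'] using this

theorem orlicz_norm_pos (hφ : IsOrliczFunction φ) {f : ℝ → ℝ}
    (hf : f ∈ (orliczSpace I φ).carrier) {p q β : ℝ} (hp : 0 ≤ p) (hpq : p < q)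
    (hq : q ∈ I.toSet) (hβ : 0 < β) (h : ∀ t ∈ Ioc p q, β ≤ |f t|) :
    0 < (orliczSpace I φ).norm f := by
  -- With `φ(u) > 1/(q - p)`, the modular of `f` at scale `β / u` exceeds `1`, so the norm is at
  -- least `β / u`.
  obtain ⟨u, hu, hlt⟩ := hφ.exists_lt (Real.toNNReal (q - p)⁻¹)
  have hu' : (0 : ℝ) < u := hu
  refine (div_pos hβ hu').trans_le (le_orlicz_norm hφ hf ?_)
  refine lt_of_lt_of_le ?_ (mul_le_modular hφ (measurableSet_Ioc (a := p) (b := q)) (β := u) ?_)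
  · rw [Interval.measure_Ioc hp hq]
    have hpos : 0 < q - p := sub_pos.2 hpq
    have h1 : (1 : ℝ≥0∞) = (Real.toNNReal (q - p)⁻¹ : ℝ≥0∞) * ENNReal.ofReal (q - p) := by
      change 1 = ENNReal.ofReal _ * _
      rw [← ENNReal.ofReal_mul (by positivity), inv_mul_cancel₀ hpos.ne', ENNReal.ofReal_one]
    rw [h1]
    exact ENNReal.mul_lt_mul_left (by simpa using hpos) ENNReal.ofReal_ne_top (hlt u le_rfl)
  · intro t ht
    rw [abs_div, abs_of_pos (div_pos hβ hu'), le_div_iff₀ (div_pos hβ hu'),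
      mul_div_cancel₀ _ hu'.ne']
    exact h t ht

/-- Normalisation: dividing by `L = ‖x‖` moves the witnesses to the unit sphere, and a given `δ` is
refuted by taking `r = (1 - δ) L`. -/
theorem not_lowerLocallyUniformlyMonotone {x : ℝ → ℝ}
    (hx : x ∈ (cesaroOrliczSpace I φ).carrier) (hpos : 0 < (cesaroOrliczSpace I φ).norm x)
    {ε : ℝ} (hε : 0 < ε)
    (h : ∀ r, 0 < r → r < (cesaroOrliczSpace I φ).norm x →
      ∃ y ∈ (cesaroOrliczSpace I φ).carrier, 0 ≤ᵐ[I.measure] y ∧ y ≤ᵐ[I.measure] x ∧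
        ε ≤ (cesaroOrliczSpace I φ).norm y ∧ r < (cesaroOrliczSpace I φ).norm (x - y)) :
    ¬ LowerLocallyUniformlyMonotone I (cesaroOrliczSpace I φ) := by
  intro H
  set L := (cesaroOrliczSpace I φ).norm x with hL
  obtain ⟨δ, hδ, H⟩ := H (fun t => x t / L) (mem_cesaro_div hpos hx)
    (by rw [cesaro_norm_div hpos, ← hL, div_self hpos.ne']) (min (ε / L) (1 / 2))
    ⟨lt_min (by positivity) (by norm_num), (min_le_right _ _).trans_lt (by norm_num)⟩
  obtain ⟨y, hy, h0, hyx, hεy, hr⟩ := h ((1 - δ) * L) (mul_pos (by linarith [hδ.2]) hpos)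
    (by nlinarith [hδ.1])
  have h1 := H (fun t => y t / L) (mem_cesaro_div hpos hy)
    (by filter_upwards [h0] with t ht using div_nonneg ht hpos.le)
    (by filter_upwards [hyx] with t ht using div_le_div_of_nonneg_right ht hpos.le)
    (by
      rw [cesaro_norm_div hpos]
      exact (min_le_left _ _).trans (div_le_div_of_nonneg_right hεy hpos.le))
  have e : (fun t => x t / L) - (fun t => y t / L) = fun t => (x - y) t / L := by
    ext t; simp [sub_div]
  rw [e, cesaro_norm_div hpos, div_le_iff₀ hpos] at h1
  exact h1.not_gt hr

/-! ### The case `a_φ > 0` -/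

theorem hasDerivAt_div_add {s t : ℝ} (h : s + t ≠ 0) :
    HasDerivAt (fun r => r / (s + r)) (s / (s + t) ^ 2) t := by
  have := (hasDerivAt_id' t).fun_div ((hasDerivAt_id' t).const_add s) h
  rwa [show 1 * (s + t) - t * 1 = s by ring] at this

theorem intervalIntegrable_div_add_sq {s : ℝ} (hs : 0 < s) {p q : ℝ} (hp : 0 ≤ p) (hq : 0 ≤ q) :
    IntervalIntegrable (fun r => s / (s + r) ^ 2) volume p q := by
  refine ContinuousOn.intervalIntegrable fun r hr => ContinuousAt.continuousWithinAt ?_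
  have : 0 ≤ r := (le_min hp hq).trans hr.1
  have : s + r ≠ 0 := by positivity
  fun_prop (disch := positivity)

theorem integral_div_add_sq {s : ℝ} (hs : 0 < s) {p q : ℝ} (hp : 0 ≤ p) (hq : 0 ≤ q) :
    ∫ r in p..q, s / (s + r) ^ 2 = q / (s + q) - p / (s + p) := by
  refine intervalIntegral.integral_eq_sub_of_hasDerivAt (f := fun r => r / (s + r))
    (fun r hr => hasDerivAt_div_add ?_) (intervalIntegrable_div_add_sq hs hp hq)
  have : 0 ≤ r := (le_min hp hq).trans hr.1
  positivity

theorem abs_div_add_sq {s : ℝ} (hs : 0 < s) (r : ℝ) : |s / (s + r) ^ 2| = s / (s + r) ^ 2 :=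
  abs_of_nonneg (by positivity)

theorem cesaro_div_add_sq {s : ℝ} (hs : 0 < s) {t : ℝ} (ht : 0 < t) :
    cesaro (fun r => |s / (s + r) ^ 2|) t = 1 / (s + t) := by
  simp only [abs_div_add_sq hs]
  rw [cesaro, integral_div_add_sq hs le_rfl ht.le]
  field_simp
  ring

theorem mem_cesaro_div_add_sq {a : ℝ≥0} (ha : 0 < a) (hφ : IsOrliczFunction φ) (h0 : φ a = 0)
    {s : ℝ} (hs : 0 < s) : (fun r => s / (s + r) ^ 2) ∈ (cesaroOrliczSpace I φ).carrier := by
  have hm : Measurable fun r : ℝ => s / (s + r) ^ 2 := by fun_prop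
  have ha' : (0 : ℝ) < a := ha
  refine ⟨hm.aemeasurable, ?_, ?_, 1 / (s * a), by positivity, ?_⟩
  · filter_upwards [I.ae_pos] with t ht
    simpa only [abs_div_add_sq hs] using intervalIntegrable_div_add_sq hs le_rfl ht.le
  · exact aemeasurable_cesaro hm.abs.aemeasurable
  · suffices h : modular I φ (fun t => cesaro (fun r => |s / (s + r) ^ 2|) t / (1 / (s * a))) = 0 by
      rw [h]; exact ENNReal.zero_lt_top
    refine (lintegral_congr_ae ?_).trans lintegral_zero
    filter_upwards [I.ae_pos] with t ht
    rw [← nonpos_iff_eq_zero, ← h0]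
    refine hφ.mono (NNReal.coe_le_coe.1 ?_)
    rw [cesaro_div_add_sq hs ht, coe_nnnorm, Real.norm_of_nonneg (by positivity)]
    rw [div_div_eq_mul_div, div_one, one_div, inv_mul_le_iff₀ (by positivity)]
    nlinarith [mul_pos ht ha']

/-- The assumption `hbig` makes the norm of `x` exceed `1/(a(s+T))`. At scales above that value `Cx`
stays below `a` beyond `T` and contributes nothing to the modular. The interval `(T₁, T₂]` serves
only to show `‖y‖ > 0`. -/
theorem not_lowerLocallyUniformlyMonotone_of_map_eq_zero (hφ : IsOrliczFunction φ) {a : ℝ≥0}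
    (ha : 0 < a) (h0 : φ a = 0) {s T : ℝ≥0} {T₁ T₂ : ℝ} (hs : 0 < s) (hsI : (s : ℝ) ∈ I.toSet)
    (hT₁ : T < T₁) (hT₂ : T₁ < T₂) (hT₂I : T₂ ∈ I.toSet)
    (hbig : 1 < φ ((s + T) * a / (4 * s)) * s) :
    ¬ LowerLocallyUniformlyMonotone I (cesaroOrliczSpace I φ) := by
  have ha' : (0 : ℝ) < a := ha
  have hs' : (0 : ℝ) < s := hs
  have hT0 : (0 : ℝ) ≤ T := T.2
  have hT₁0 : (0 : ℝ) < T₁ := hT0.trans_lt hT₁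
  set x : ℝ → ℝ := fun r => s / (s + r) ^ 2 with hx
  have hxm : x ∈ (cesaroOrliczSpace I φ).carrier := mem_cesaro_div_add_sq ha hφ h0 hs'
  have hx0 : ∀ t, 0 ≤ x t := fun t => by positivity
  have hCx : ∀ t, 0 < t → cesaro (fun r => |x r|) t = 1 / (s + t) :=
    fun t ht => cesaro_div_add_sq hs' ht
  set L := (cesaroOrliczSpace I φ).norm x with hL
  -- On `(0, s]` one has `Cx ≥ 1/(2s)`; at scale `2/(a(s+T))` this becomes `(s+T)a/(4s)`, the
  -- argument in `hbig`. The factor `2` leaves room for the strict inequality `hc0`.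
  have hLge : 2 / (a * (s + T)) ≤ L := by
    refine le_orlicz_norm hφ hxm.2.2 (hbig.trans_le ?_)
    have hm : I.measure (Ioc 0 (s : ℝ)) = s := by
      rw [Interval.measure_Ioc le_rfl hsI]; simp
    rw [← hm]
    refine mul_le_modular hφ measurableSet_Ioc fun t ht => ?_
    have ht0 := ht.1
    rw [hCx t ht.1, abs_of_nonneg (by positivity)]
    push_cast
    calc (s + T : ℝ) * a / (4 * s) = (1 / (s + s)) / (2 / (a * (s + T))) := by field_simp; norm_num
      _ ≤ (1 / (s + t)) / (2 / (a * (s + T))) := by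
        gcongr
        exact ht.2
  have hc0 : 1 / (a * (s + T)) < L := by
    refine lt_of_lt_of_le ?_ hLge
    gcongr
    norm_num
  have hLpos : 0 < L := lt_trans (by positivity) hc0
  set y : ℝ → ℝ := (Ioi (T : ℝ)).indicator x with hy
  have hy0 : ∀ t, 0 ≤ y t := fun t => indicator_nonneg (fun t _ => hx0 t) t
  have hyx : ∀ t, y t ≤ x t := fun t => indicator_le_self' (fun t _ => hx0 t) t
  have hym : y ∈ (cesaroOrliczSpace I φ).carrier :=
    mem_cesaro_of_le hφ hxm (hxm.1.indicator measurableSet_Ioi)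
      (Eventually.of_forall fun t => abs_le_abs_of_nonneg (hy0 t) (hyx t))
  have hxym : x - y ∈ (cesaroOrliczSpace I φ).carrier :=
    mem_cesaro_of_le hφ hxm (hxm.1.sub hym.1) (Eventually.of_forall fun t =>
      abs_le_abs_of_nonneg (sub_nonneg.2 (hyx t)) (sub_le_self _ (hy0 t)))
  have hmono : ∀ p q : ℝ, 0 ≤ p → p < q → p / (s + p) < q / (s + q) := fun p q hp hpq => by
    rw [div_lt_div_iff₀ (by positivity) (by linarith)]
    nlinarith
  have hypos : 0 < (cesaroOrliczSpace I φ).norm y := by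
    have hβ : 0 < T₁ / (s + T₁) - T / (s + T) := sub_pos.2 (hmono _ _ hT0 hT₁)
    have hT₂0 : 0 < T₂ := hT₁0.trans hT₂
    refine orlicz_norm_pos hφ hym.2.2 hT₁0.le hT₂ hT₂I
      (β := (1 / T₂) * (T₁ / (s + T₁) - T / (s + T))) (by positivity) fun t ht => ?_
    have ht0 : 0 < t := hT₁0.trans ht.1
    have hTt : (T : ℝ) ≤ t := (hT₁.trans ht.1).le
    have hi : ∀ p q : ℝ, 0 ≤ p → p ≤ q → IntervalIntegrable (fun r => |y r|) volume p q := by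
      intro p q hp hpq
      have := intervalIntegrable_div_add_sq hs' hp (hp.trans hpq)
      rw [intervalIntegrable_iff_integrableOn_Ioc_of_le hpq] at this ⊢
      exact (Integrable.indicator this measurableSet_Ioi).abs
    rw [abs_of_nonneg (cesaro_abs_nonneg _ ht0.le)]
    refine mul_le_mul (one_div_le_one_div_of_le ht0 ht.2) ?_ hβ.le (by positivity)
    rw [← intervalIntegral.integral_add_adjacent_intervals (hi 0 T le_rfl hT0) (hi T t hT0 hTt)]
    have h1 : 0 ≤ ∫ r in (0 : ℝ)..T, |y r| :=
      intervalIntegral.integral_nonneg hT0 fun _ _ => abs_nonneg _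
    have h2 : ∫ r in (T : ℝ)..t, |y r| = t / (s + t) - T / (s + T) := by
      rw [← integral_div_add_sq hs' hT0 ht0.le]
      refine intervalIntegral.integral_congr_ae (Eventually.of_forall fun r hr => ?_)
      rw [uIoc_of_le hTt] at hr
      change |y r| = x r
      rw [abs_of_nonneg (hy0 r), hy, indicator_of_mem (show r ∈ Ioi (T : ℝ) from hr.1)]
    have := hmono T₁ t hT₁0.le ht.1
    linarith
  refine not_lowerLocallyUniformlyMonotone hxm hLpos hypos fun r hr hrL =>
    ⟨y, hym, Eventually.of_forall hy0, Eventually.of_forall hyx, le_rfl, hrL.trans_le ?_⟩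
  by_contra! hlt
  -- At scale `c` the functions `Cx` and `C(x - y)` agree up to `T`, and beyond `T` the modular of
  -- `Cx` vanishes. Thus `‖x‖ ≤ c`, a contradiction.
  obtain ⟨c, hc1, hcL⟩ := exists_between (max_lt hlt hc0)
  have hcpos : 0 < c := lt_trans (by positivity) ((le_max_right _ _).trans_lt hc1)
  have hmod := modular_le_one_of_norm_lt hφ hxym.2.2 ((le_max_left _ _).trans_lt hc1)
  refine hcL.not_ge (orlicz_norm_le hcpos (le_trans (lintegral_mono_ae ?_) hmod))
  filter_upwards [I.ae_pos] with t ht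
  rcases le_or_gt t T with htT | htT
  · have : cesaro (fun r => |x r|) t = cesaro (fun r => |(x - y) r|) t := by
      rw [cesaro, cesaro]
      congr 1
      refine intervalIntegral.integral_congr_ae (Eventually.of_forall fun r hr => ?_)
      rw [uIoc_of_le ht.le] at hr
      have : y r = 0 := indicator_of_notMem (by simpa using hr.2.trans htT) _
      simp [this]
    rw [this]
  · refine le_of_eq_of_le ?_ zero_le
    rw [← nonpos_iff_eq_zero, ← h0]
    refine hφ.mono (NNReal.coe_le_coe.1 ?_)
    rw [hCx t ht, coe_nnnorm, Real.norm_of_nonneg (by positivity), div_le_iff₀ hcpos]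
    calc 1 / (s + t : ℝ) ≤ 1 / (s + T) := by gcongr
      _ = a * (1 / (a * (s + T))) := by field_simp
      _ ≤ a * c := by gcongr; exact ((le_max_right _ _).trans_lt hc1).le

theorem aIndex_eq_zero_of_lowerLocallyUniformlyMonotone (hφ : IsOrliczFunction φ)
    (hlim : I = Interval.unit → Tendsto (fun u : ℝ≥0 => φ u / (u : ℝ≥0∞)) atTop (𝓝 ∞))
    (h : LowerLocallyUniformlyMonotone I (cesaroOrliczSpace I φ)) : aIndex φ = 0 := by
  by_contra hne
  obtain ⟨a, ha, h0⟩ := IsOrliczFunction.exists_zero_of_aIndex hne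
  cases I with
  | unit =>
    obtain ⟨u, hu1, hu2, hu3⟩ := (((hlim rfl).eventually (lt_mem_nhds
      (ENNReal.coe_lt_top (r := 8 / a)))).and ((eventually_ge_atTop (a / 8)).and
      (eventually_gt_atTop 0))).exists
    -- With `T = 1/2` the argument in `hbig` is at least `a/(8s)`, which equals `u` for this `s`;
    -- the growth of `φ(u)/u` supplies `φ(u) > 8u/a = 1/s`, and `u ≥ a/8` gives `s ≤ 1`.
    have hs : 0 < a / (8 * u) := by positivity
    refine not_lowerLocallyUniformlyMonotone_of_map_eq_zero (I := .unit) hφ ha h0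
      (s := a / (8 * u)) (T := 1 / 2) (T₁ := 3 / 4) (T₂ := 1) hs ?_ (by norm_num) (by norm_num)
      ⟨zero_le_one, le_rfl⟩ ?_ h
    · refine ⟨NNReal.coe_nonneg _, ?_⟩
      rw [← NNReal.coe_one, NNReal.coe_le_coe, div_le_one₀ (by positivity)]
      rwa [div_le_iff₀' (by positivity)] at hu2
    · have hu : u ≤ (a / (8 * u) + 1 / 2) * a / (4 * (a / (8 * u))) := by
        rw [le_div_iff₀ (by positivity)]
        calc u * (4 * (a / (8 * u))) = 1 / 2 * a := by field_simp; norm_num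
          _ ≤ _ := by gcongr; exact le_add_self
      have h1 : ((8 / a : ℝ≥0) : ℝ≥0∞) * u < φ u := by
        rwa [ENNReal.lt_div_iff_mul_lt (by simp [hu3.ne']) (by simp)] at hu1
      calc (1 : ℝ≥0∞) = ((8 / a : ℝ≥0) : ℝ≥0∞) * u * (a / (8 * u) : ℝ≥0) := by
            rw [← ENNReal.coe_mul, ← ENNReal.coe_mul, ← ENNReal.coe_one]
            congr 1
            field_simp
        _ < φ u * (a / (8 * u) : ℝ≥0) :=
            ENNReal.mul_lt_mul_left (by simpa using hs.ne') ENNReal.coe_ne_top h1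
        _ ≤ _ := by gcongr; exact hφ.mono hu
  | halfLine =>
    obtain ⟨u, hu, hlt⟩ := hφ.exists_lt 1
    -- On the half-line `s = 1` is enough, since `T` may be large: `(1 + T)a/4 ≥ u`.
    refine not_lowerLocallyUniformlyMonotone_of_map_eq_zero (I := .halfLine) hφ ha h0
      (s := 1) (T := 4 * u / a) (T₁ := (4 * u / a : ℝ≥0) + 1) (T₂ := (4 * u / a : ℝ≥0) + 2) one_pos
      (NNReal.coe_nonneg 1) (by simp) (by norm_num) (by change (0 : ℝ) ≤ _; positivity) ?_ h
    rw [ENNReal.coe_one, mul_one]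
    refine hlt _ ?_
    rw [le_div_iff₀ (by positivity)]
    calc u * (4 * 1) = 4 * u / a * a := by field_simp
      _ ≤ _ := by gcongr; exact le_add_self

/-! ### Failure of the condition `Δ₂` -/

/-- The function with value `c` on `(-∞, m]` and `0` on `(m, ∞)`. -/
noncomputable def step (m c : ℝ≥0) : ℝ → ℝ := (Iic (m : ℝ)).indicator fun _ => (c : ℝ)

theorem step_nonneg (m c : ℝ≥0) (t : ℝ) : 0 ≤ step m c t := indicator_nonneg (fun _ _ => c.2) t

theorem step_of_le {m c : ℝ≥0} {t : ℝ} (h : t ≤ m) : step m c t = c :=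
  indicator_of_mem (mem_Iic.2 h) _

theorem step_of_lt {m c : ℝ≥0} {t : ℝ} (h : m < t) : step m c t = 0 :=
  indicator_of_notMem (by simpa using h) _

theorem step_le (m c : ℝ≥0) (t : ℝ) : step m c t ≤ c := indicator_le_self' (fun _ _ => c.2) t

theorem measurable_step (m c : ℝ≥0) : Measurable (step m c) :=
  measurable_const.indicator measurableSet_Iic

theorem modular_step_le (hφ : IsOrliczFunction φ) (m c : ℝ≥0) :
    modular I φ (step m c) ≤ φ c * m := by
  calc modular I φ (step m c) ≤ ∫⁻ t, (Iic (m : ℝ)).indicator (fun _ => φ c) t ∂I.measure := by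
        refine lintegral_mono fun t => ?_
        rcases le_or_gt t m with h | h
        · rw [step_of_le h, indicator_of_mem (mem_Iic.2 h)]; simp
        · rw [step_of_lt h]; simp [hφ.map_zero]
    _ = φ c * I.measure (Iic (m : ℝ)) := by
        rw [lintegral_indicator measurableSet_Iic]; simp
    _ ≤ φ c * m := by
        gcongr
        simpa using Interval.measure_Iic_le (I := I) (m : ℝ)

/-- The supremum of the steps with index at least `N`. -/
noncomputable def tailSup (m u : ℕ → ℝ≥0) (N : ℕ) (t : ℝ) : ℝ := ⨆ n, step (m (N + n)) (u (N + n)) t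

section tailSup

variable {m u : ℕ → ℝ≥0} {t : ℝ}

theorem tailSup_nonneg (N : ℕ) (t : ℝ) : 0 ≤ tailSup m u N t :=
  Real.iSup_nonneg fun _ => step_nonneg _ _ _

theorem measurable_tailSup (N : ℕ) : Measurable (tailSup m u N) :=
  Measurable.iSup fun _ => measurable_step _ _

/-- An unbounded real supremum has the default value `0`; convergence of the steps at `t` excludes
this. For `t ≤ 0` every step takes its full height, so convergence is assumed later only for `t >
0`. -/
theorem bddAbove_step (h : Tendsto (fun n => step (m n) (u n) t) atTop (𝓝 0)) (N : ℕ) :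
    BddAbove (range fun n => step (m (N + n)) (u (N + n)) t) := by
  refine h.bddAbove_range.mono ?_
  rintro _ ⟨n, rfl⟩
  exact ⟨N + n, rfl⟩

theorem step_le_tailSup (h : Tendsto (fun n => step (m n) (u n) t) atTop (𝓝 0)) (N : ℕ) :
    step (m N) (u N) t ≤ tailSup m u N t := le_ciSup (bddAbove_step h N) 0

theorem tailSup_le_tailSup_zero (h : Tendsto (fun n => step (m n) (u n) t) atTop (𝓝 0)) (N : ℕ) :
    tailSup m u N t ≤ tailSup m u 0 t := by
  refine ciSup_le fun n => ?_
  have := le_ciSup (bddAbove_step h 0) (N + n)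
  simpa [tailSup] using this

theorem tendsto_tailSup (h : Tendsto (fun n => step (m n) (u n) t) atTop (𝓝 0)) :
    Tendsto (fun N => tailSup m u N t) atTop (𝓝 0) := by
  refine tendsto_order.2 ⟨fun b hb => Eventually.of_forall fun N => hb.trans_le
    (tailSup_nonneg N t), fun b hb => ?_⟩
  obtain ⟨N, hN⟩ := eventually_atTop.1 (h.eventually (gt_mem_nhds (half_pos hb)))
  filter_upwards [eventually_ge_atTop N] with M hM
  exact (ciSup_le fun n => (hN (M + n) (by omega)).le).trans_lt (half_lt_self hb)

end tailSup

theorem not_lowerLocallyUniformlyMonotone_of_steps (hφ : IsOrliczFunction φ)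
    (hC : ∀ f ∈ (orliczSpace I φ).carrier, cesaro f ∈ (orliczSpace I φ).carrier)
    {m u : ℕ → ℝ≥0} (hmI : ∀ n, (m n : ℝ) ∈ I.toSet)
    (h0 : ∀ t : ℝ, 0 < t → Tendsto (fun n => step (m n) (u n) t) atTop (𝓝 0))
    (hsum : ∑' n, φ (u n) * m n ≠ ∞) (hbig : ∀ n, 1 < φ (2 * u n) * m n) :
    ¬ LowerLocallyUniformlyMonotone I (cesaroOrliczSpace I φ) := by
  set x := tailSup m u 0 with hx
  have hxφ : x ∈ (orliczSpace I φ).carrier := by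
    refine ⟨(measurable_tailSup 0).aemeasurable, 2, two_pos, ?_⟩
    calc modular I φ (fun t => x t / 2)
        ≤ ∫⁻ t, ∑' n, φ ‖step (m n) (u n) t‖₊ ∂I.measure := by
          refine lintegral_mono fun t => ?_
          rcases (tailSup_nonneg (m := m) (u := u) 0 t).eq_or_lt with h | h
          · have hxt : x t = 0 := h.symm
            simp [hxt, hφ.map_zero]
          -- The supremum need not be attained, but some step exceeds half of it; hence the scale
          -- `2`.
          · obtain ⟨n, hn⟩ := exists_lt_of_lt_ciSup (half_lt_self h)
            rw [zero_add] at hn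
            refine le_trans (hφ.mono (NNReal.coe_le_coe.1 ?_)) (ENNReal.le_tsum n)
            rw [coe_nnnorm, coe_nnnorm, Real.norm_of_nonneg (step_nonneg _ _ _),
              Real.norm_of_nonneg (half_pos h).le]
            exact hn.le
      _ = ∑' n, modular I φ (step (m n) (u n)) :=
          lintegral_tsum fun n => aemeasurable_comp hφ (measurable_step _ _).aemeasurable
      _ ≤ ∑' n, φ (u n) * m n := ENNReal.tsum_le_tsum fun n => modular_step_le hφ _ _
      _ < ∞ := hsum.lt_top
  have habs : ∀ N, (fun t => |tailSup m u N t|) = tailSup m u N := fun N =>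
    funext fun t => abs_of_nonneg (tailSup_nonneg N t)
  have hxint : ∀ t ∈ I.toSet, IntervalIntegrable x volume 0 t := fun t ht =>
    intervalIntegrable_of_mem_orlicz hφ hxφ ht
  have hxm : x ∈ (cesaroOrliczSpace I φ).carrier := by
    refine ⟨hxφ.1, ?_, ?_⟩
    · rw [hx, habs]
      filter_upwards [I.ae_mem] with t ht using hxint t ht
    · rw [hx, habs]
      exact hC _ hxφ
  have hyx : ∀ N t, 0 < t → tailSup m u N t ≤ x t := fun N t ht =>
    tailSup_le_tailSup_zero (h0 t ht) N
  have hym : ∀ N, tailSup m u N ∈ (cesaroOrliczSpace I φ).carrier := fun N =>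
    mem_cesaro_of_le hφ hxm (measurable_tailSup N).aemeasurable (by
      filter_upwards [I.ae_pos] with t ht
        using abs_le_abs_of_nonneg (tailSup_nonneg N t) (hyx N t ht))
  have hxym : ∀ N, x - tailSup m u N ∈ (cesaroOrliczSpace I φ).carrier := fun N =>
    mem_cesaro_of_le hφ hxm (hxm.1.sub (hym N).1) (by
      filter_upwards [I.ae_pos] with t ht
        using abs_le_abs_of_nonneg (sub_nonneg.2 (hyx N t ht)) (sub_le_self _ (tailSup_nonneg N t)))
  have hyn : ∀ N, 1 / 2 ≤ (cesaroOrliczSpace I φ).norm (tailSup m u N) := by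
    intro N
    refine le_orlicz_norm hφ (hym N).2.2 ((hbig N).trans_le ?_)
    have hm : I.measure (Ioc 0 (m N : ℝ)) = m N := by
      rw [Interval.measure_Ioc le_rfl (hmI N)]; simp
    rw [← hm]
    refine mul_le_modular hφ measurableSet_Ioc fun t ht => ?_
    have htI : t ∈ I.toSet := Interval.Ioc_subset (hmI N) ht
    -- On `(0, m N]` the tail is at least the constant `u N`, and averaging preserves constants. At
    -- scale `1/2` this yields modular at least `φ(2 u N) m N > 1`.
    have hle : (u N : ℝ) ≤ cesaro (fun s => |tailSup m u N s|) t := by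
      have hconst : cesaro (fun _ => (u N : ℝ)) t = u N := by
        have := ht.1.ne'
        simp only [cesaro, intervalIntegral.integral_const, smul_eq_mul, sub_zero]
        field_simp
      rw [← hconst, habs]
      rw [cesaro, cesaro]
      refine mul_le_mul_of_nonneg_left ?_ (one_div_nonneg.2 ht.1.le)
      have hint : IntervalIntegrable (tailSup m u N) volume 0 t :=
        intervalIntegrable_of_mem_orlicz hφ (mem_orlicz_of_le hφ hxφ
          (measurable_tailSup N).aemeasurable (by
            filter_upwards [I.ae_pos] with t ht
              using abs_le_abs_of_nonneg (tailSup_nonneg N t) (hyx N t ht))) htI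
      refine intervalIntegral.integral_mono_on_of_le_Ioo ht.1.le (by simp) hint fun s hs => ?_
      rw [← step_of_le (hs.2.le.trans ht.2) (c := u N)]
      exact step_le_tailSup (h0 s hs.1) N
    rw [abs_of_nonneg (div_nonneg ((u N).2.trans hle) (by norm_num))]
    push_cast
    linarith
  have hpos : 0 < (cesaroOrliczSpace I φ).norm x := lt_of_lt_of_le (by norm_num) (hyn 0)
  refine not_lowerLocallyUniformlyMonotone hxm hpos one_half_pos fun r hr hrL => ?_
  by_contra! hcon
  have hle : ∀ N, (cesaroOrliczSpace I φ).norm (x - tailSup m u N) ≤ r := fun N =>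
    hcon _ (hym N) (Eventually.of_forall (tailSup_nonneg N))
      (by filter_upwards [I.ae_pos] with t ht using hyx N t ht) (hyn N)
  obtain ⟨c, hrc, hcL⟩ := exists_between hrL
  -- At a scale `c` strictly between `r` and `‖x‖` all modulars of `C|x - y_N|` are at most `1`.
  -- Dominated convergence, with `x` as majorant, gives `C|x - y_N| → Cx`, so the bound passes to
  -- `Cx`.
  refine hcL.not_ge (orlicz_norm_le (hr.trans hrc) (modular_le_of_tendsto hφ
    (F := fun N t => cesaro (fun s => |(x - tailSup m u N) s|) t / c)
    (fun N => (hxym N).2.2.1.div_const c) ?_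
    fun N => modular_le_one_of_norm_lt hφ (hxym N).2.2 ((hle N).trans_lt hrc)))
  filter_upwards [I.ae_mem] with t ht
  have ht0 := Interval.nonneg_of_mem ht
  refine Tendsto.div_const (Tendsto.const_mul _ ?_) _
  refine intervalIntegral.tendsto_integral_filter_of_dominated_convergence x
    (Eventually.of_forall fun N =>
      ((measurable_tailSup 0).sub (measurable_tailSup N)).abs.aestronglyMeasurable)
    (Eventually.of_forall fun N => Eventually.of_forall fun s hs => ?_) (hxint t ht)
    (Eventually.of_forall fun s hs => ?_)
  · rw [uIoc_of_le ht0] at hs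
    rw [Real.norm_eq_abs, abs_abs, Pi.sub_apply, abs_of_nonneg (sub_nonneg.2 (hyx N s hs.1))]
    exact sub_le_self _ (tailSup_nonneg N s)
  · rw [uIoc_of_le ht0] at hs
    simpa using ((tendsto_const_nhds (x := x s)).sub (tendsto_tailSup (h0 s hs.1))).abs

/-- The lengths `mₙ = 1/(2ⁿ φ(uₙ))` give `φ(uₙ) mₙ = 2⁻ⁿ`, which is summable, and `φ(2uₙ) mₙ > 1`.
Either alternative in `h0` makes the steps vanish pointwise on `t > 0`: the heights tend to `0`, or
the lengths are at most `2⁻ⁿ`. -/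
theorem not_lowerLocallyUniformlyMonotone_of_seq (hφ : IsOrliczFunction φ)
    (hfin : ∀ u, φ u < ∞)
    (hC : ∀ f ∈ (orliczSpace I φ).carrier, cesaro f ∈ (orliczSpace I φ).carrier)
    {u : ℕ → ℝ≥0} (hu0 : ∀ n, φ (u n) ≠ 0) (hu : ∀ n, 2 ^ n * φ (u n) < φ (2 * u n))
    (hmI : ∀ n, ((2 ^ n * (φ (u n)).toNNReal)⁻¹ : ℝ) ∈ I.toSet)
    (h0 : Tendsto u atTop (𝓝 0) ∨ ∀ n, 1 ≤ φ (u n)) :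
    ¬ LowerLocallyUniformlyMonotone I (cesaroOrliczSpace I φ) := by
  have hp : ∀ n, φ (u n) = (φ (u n)).toNNReal := fun n => (ENNReal.coe_toNNReal (hfin _).ne).symm
  have hp0 : ∀ n, (φ (u n)).toNNReal ≠ 0 := fun n =>
    ENNReal.toNNReal_ne_zero.2 ⟨hu0 n, (hfin _).ne⟩
  refine not_lowerLocallyUniformlyMonotone_of_steps hφ hC (u := u)
    (m := fun n => (2 ^ n * (φ (u n)).toNNReal)⁻¹) (fun n => by exact_mod_cast hmI n) ?_ ?_ ?_
  · intro t ht
    rcases h0 with h0 | h0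
    · refine squeeze_zero (fun n => step_nonneg _ _ _) (fun n => step_le _ _ _) ?_
      simpa using (NNReal.tendsto_coe (x := 0)).2 h0
    · refine tendsto_const_nhds.congr' ?_
      filter_upwards [(tendsto_pow_atTop_nhds_zero_of_lt_one (by norm_num : (0 : ℝ) ≤ 1 / 2)
        (by norm_num)).eventually (gt_mem_nhds ht)] with n hn
      refine (step_of_lt (lt_of_le_of_lt ?_ hn)).symm
      have h1 : 1 ≤ (φ (u n)).toNNReal := by
        have := h0 n
        rw [hp n] at this
        exact_mod_cast this
      have h2 : (1 : ℝ) ≤ (φ (u n)).toNNReal := h1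
      push_cast
      rw [one_div, inv_pow, mul_inv]
      exact mul_le_of_le_one_right (by positivity) (inv_le_one_of_one_le₀ h2)
  · have : ∀ n, φ (u n) * ((2 ^ n * (φ (u n)).toNNReal)⁻¹ : ℝ≥0) = (2⁻¹ : ℝ≥0∞) ^ n := fun n => by
      nth_rw 1 [hp n]
      rw [← ENNReal.coe_mul, mul_inv, mul_left_comm, mul_inv_cancel₀ (hp0 n), mul_one]
      simp [ENNReal.inv_pow]
    simp_rw [this, ENNReal.tsum_geometric]
    simp
  · intro n
    have hpos : (2 ^ n * (φ (u n)).toNNReal)⁻¹ ≠ 0 := inv_ne_zero (mul_ne_zero (by simp) (hp0 n))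
    have := ENNReal.mul_lt_mul_left (ENNReal.coe_ne_zero.2 hpos) ENNReal.coe_ne_top (hu n)
    refine lt_of_eq_of_lt ?_ this
    nth_rw 1 [hp n]
    rw [← ENNReal.coe_one, ← ENNReal.coe_inj.2 (mul_inv_cancel₀ (mul_ne_zero (pow_ne_zero n two_ne_zero) (hp0 n)))]
    push_cast
    rfl

theorem deltaTwoLarge_of_lowerLocallyUniformlyMonotone (hφ : IsOrliczFunction φ)
    (hfin : ∀ u, φ u < ∞)
    (hC : ∀ f ∈ (orliczSpace I φ).carrier, cesaro f ∈ (orliczSpace I φ).carrier)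
    (h : LowerLocallyUniformlyMonotone I (cesaroOrliczSpace I φ)) : DeltaTwoLarge φ := by
  by_contra hne
  unfold DeltaTwoLarge at hne
  push Not at hne
  obtain ⟨v, hv, hv1⟩ := hφ.exists_lt 1
  choose u huv hu using fun n : ℕ => hne (2 ^ n) v (by positivity) hv (hfin v)
  have h1 : ∀ n, 1 ≤ φ (u n) := fun n => (hv1 _ (huv n)).le
  refine not_lowerLocallyUniformlyMonotone_of_seq hφ hfin hC
    (fun n => (zero_lt_one.trans_le (h1 n)).ne') (fun n => by simpa using hu n) (fun n => ?_)
    (.inr h1) h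
  have h2 : (1 : ℝ) ≤ (φ (u n)).toNNReal := by
    have := h1 n
    rw [← ENNReal.coe_toNNReal (hfin (u n)).ne] at this
    exact_mod_cast this
  have h3 : (1 : ℝ) ≤ 2 ^ n * (φ (u n)).toNNReal :=
    one_le_mul_of_one_le_of_one_le (one_le_pow₀ one_le_two) h2
  cases I
  · exact ⟨by positivity, inv_le_one_of_one_le₀ h3⟩
  · change (0 : ℝ) ≤ _
    positivity

theorem deltaTwo_of_lowerLocallyUniformlyMonotone (hφ : IsOrliczFunction φ)
    (hfin : ∀ u, φ u < ∞)
    (hC : ∀ f ∈ (orliczSpace I φ).carrier, cesaro f ∈ (orliczSpace I φ).carrier)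
    (ha : aIndex φ = 0)
    (h : LowerLocallyUniformlyMonotone I (cesaroOrliczSpace I φ)) : DeltaTwo I φ := by
  have hlarge := deltaTwoLarge_of_lowerLocallyUniformlyMonotone hφ hfin hC h
  cases I with
  | unit => exact hlarge
  | halfLine =>
    by_contra hne
    simp only [DeltaTwo, DeltaTwoAll] at hne
    push Not at hne
    have key : ∀ n : ℕ, ∃ u : ℝ≥0, 0 < u ∧ u ≤ 1 / (n + 1) ∧ 2 ^ n * φ u < φ (2 * u) := by
      intro n
      obtain ⟨K, hK, hK2⟩ := exists_map_two_mul_le_of_large hφ hfin ha hlarge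
        (u₁ := 1 / (n + 1)) (by positivity)
      -- The constant `K` works for all arguments from `1/(n+1)` on, so a violation with a constant
      -- at least `K` must occur below `1/(n+1)`; thus the violating points tend to `0`.
      obtain ⟨u, hu⟩ := hne (max K (2 ^ n)) (lt_max_of_lt_left hK)
      refine ⟨u, ?_, ?_, lt_of_le_of_lt ?_ hu⟩
      · rw [pos_iff_ne_zero]
        rintro rfl
        simp [hφ.map_zero] at hu
      · by_contra! hlt
        refine hu.not_ge ((hK2 u hlt.le).trans ?_)
        gcongr
        exact le_max_left _ _
      · gcongr
        exact_mod_cast le_max_right K (2 ^ n)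
    choose u hu0 hun hu using key
    refine not_lowerLocallyUniformlyMonotone_of_seq hφ hfin hC
      (fun n => (IsOrliczFunction.map_pos_of_aIndex ha (hu0 n)).ne') hu (fun n => ?_) (.inl ?_) h
    · change (0 : ℝ) ≤ _
      positivity
    · exact tendsto_of_tendsto_of_tendsto_of_le_of_le tendsto_const_nhds
        (tendsto_one_div_add_atTop_nhds_zero_nat (𝕜 := ℝ≥0)) (fun _ => zero_le) hun

theorem UniformlyMonotone.lowerLocallyUniformlyMonotone {X : FunctionSpace}
    (h : UniformlyMonotone I X) : LowerLocallyUniformlyMonotone I X := by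
  intro x hx hnx ε hε
  obtain ⟨δ, hδ, H⟩ := h ε hε
  exact ⟨δ, hδ, fun y hy h0 hyx hny => H x hx y hy h0 hyx hnx hny⟩

end CesaroOrlicz

theorem theorem11 (I : CesaroOrlicz.Interval) (φ : ℝ≥0 → ℝ≥0∞)
    (hφ : CesaroOrlicz.IsOrliczFunction φ)
    (hfin : CesaroOrlicz.bIndex φ = ∞)
    (hC : ∀ f ∈ (CesaroOrlicz.orliczSpace I φ).carrier,
      CesaroOrlicz.cesaro f ∈ (CesaroOrlicz.orliczSpace I φ).carrier)
    (hlim : I = CesaroOrlicz.Interval.unit →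
      Tendsto (fun u : ℝ≥0 => φ u / (u : ℝ≥0∞)) atTop (𝓝 ∞)) :
    List.TFAE [
      CesaroOrlicz.UniformlyMonotone I (CesaroOrlicz.cesaroOrliczSpace I φ),
      CesaroOrlicz.LowerLocallyUniformlyMonotone I (CesaroOrlicz.cesaroOrliczSpace I φ),
      CesaroOrlicz.aIndex φ = 0 ∧ CesaroOrlicz.DeltaTwo I φ] := by
  have hlt := hφ.lt_top_of_bIndex hfin
  tfae_have 1 → 2 := CesaroOrlicz.UniformlyMonotone.lowerLocallyUniformlyMonotone
  tfae_have 2 → 3 := fun h => by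
    have ha := CesaroOrlicz.aIndex_eq_zero_of_lowerLocallyUniformlyMonotone hφ hlim h
    exact ⟨ha, CesaroOrlicz.deltaTwo_of_lowerLocallyUniformlyMonotone hφ hlt hC ha h⟩
  tfae_have 3 → 1 := fun h => CesaroOrlicz.uniformlyMonotone_of_deltaTwo hφ hlt h.1 h.2
  tfae_finish
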